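/- Let $D\subset\mathbb R^2$ be any Lagrangian diagram obtained from a generic front diagram of a (non-empty) Legendrian knot or link by Ng's resolution: each crossing of the front becomes a crossing of $D$ in which the strand of smaller slope is the overstrand, each left cusp is smoothed, each right cusp is replaced by a crossing with a small loop on its right (the strand that is upper on the left of the crossing being the overstrand), and $D$ is considered up to planar isotopy. Let $q_1,\dots,q_n$ be the crossings of $D$. An area patch is a bounded connected component $P$ of $\mathbb R^2\setminus D$; a corner of $P$ has Reeb sign $+1$ if, traversing $\partial P$ with its boundary orientation, one passes there from the understrand to the overstrand, and $-1$ otherwise. The area inequality of $P$ is $\sum_j\alpha_{P,j}h(q_j)>0$, where $\alpha_{P,j}$ is the sum of the Reeb signs of the corners of $P$ at $q_j$. Let $\mathcal R$ be the set of area inequalities of $D$. The flooding algorithm starts with $\mathcal R'=\mathcal R$ and $k=1$, and proceeds as follows. (1) Let $T_k$ be the set of all crossings $q_j$ that are in no earlier tier and have coefficient $\ge 0$ in every inequality of $\mathcal R'$. (2) If $T_k=\emptyset$, stop: the algorithm fails. Otherwise remove from $\mathcal R'$ every inequality in which some $q_j\in T_k$ has positive coefficient. (3) If $\mathcal R'\neq\emptyset$,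 increase $k$ by $1$ and return to (1); if $\mathcal R'=\emptyset$, let $T_{k+1}$ be the set of all crossings in none of $T_1,\dots,T_k$, put $M=k+1$, and stop successfully. Then the flooding algorithm applied to $D$ does not fail, and it assigns every crossing to exactly one tier: $T_1\sqcup\cdots\sqcup T_M=\{q_1,\dots,q_n\}$. -/

import Mathlib

open Set Filter Topology

/-- The plane. In a front diagram the coordinates are `(x, z)`; a knot diagram obtained from it
by resolution lives in the `(x, y)`-plane. -/
abbrev Plane : Type := ℝ × ℝ

/-! ### Planar diagrams with crossings, area patches, Reeb signs, area inequalities -/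

/-- The data of a knot (or link) diagram in the plane whose crossings are indexed by `Q`.

At a crossing `q` the diagram has four half-strands `0, 1, 2, 3`, listed counterclockwise, and
four quadrants `0, 1, 2, 3`, where quadrant `i` lies between half-strand `i` and half-strand
`i + 1`. A quadrant is recorded as a filter on the plane that is concentrated, near the crossing,
inside the quadrant. `isOver q i` says that half-strand `i` is part of the overstrand at `q`. -/
structure CrossingDiagram (Q : Type) where
  carrier : Set Plane
  pos : Q → Plane
  quadrant : Q → Fin 4 → Filter Plane
  isOver : Q → Fin 4 → Bool
  isOver_opposite : ∀ q i, isOver q (i + 2) = isOver q i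
  isOver_adjacent : ∀ q i, isOver q (i + 1) = !isOver q i

namespace CrossingDiagram

variable {Q : Type}

/-- An area patch: a bounded connected component of the complement of the diagram. -/
def IsAreaPatch (D : CrossingDiagram Q) (P : Set Plane) : Prop :=
  (∃ p ∈ D.carrierᶜ, P = connectedComponentIn D.carrierᶜ p) ∧ Bornology.IsBounded P

/-- The Reeb sign of quadrant `i` at `q`. A patch that occupies quadrant `i` is on the left of its
oriented boundary, so the boundary arrives at the corner along half-strand `i + 1` and leaves it
along half-strand `i`. The sign is positive if this is a passage from the understrand to the
overstrand, and negative otherwise. -/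
def reebSign (D : CrossingDiagram Q) (q : Q) (i : Fin 4) : ℤ :=
  if D.isOver q (i + 1) = false ∧ D.isOver q i = true then 1 else -1

open Classical in
/-- The coefficient of the height `h(q)` in the area inequality of the patch `P`: the sum of the
Reeb signs of the corners of `P` at `q`. -/
noncomputable def areaCoeff (D : CrossingDiagram Q) (P : Set Plane) (q : Q) : ℤ :=
  ∑ i : Fin 4, if P ∈ D.quadrant q i then D.reebSign q i else 0

/-- The area inequalities of the diagram. The inequality `∑ q, f q * h q > 0` in the unknown
heights `h` is recorded by its coefficients `f : Q → ℤ`. -/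
def areaInequalities (D : CrossingDiagram Q) : Set (Q → ℤ) :=
  {f | ∃ P, D.IsAreaPatch P ∧ f = D.areaCoeff P}

/-- The image of a diagram under a homeomorphism of the plane (only used for homeomorphisms that
are isotopic to the identity, which preserve the counterclockwise order at each crossing). -/
def map (D : CrossingDiagram Q) (h : Plane ≃ₜ Plane) : CrossingDiagram Q where
  carrier := h '' D.carrier
  pos q := h (D.pos q)
  quadrant q i := Filter.map h (D.quadrant q i)
  isOver := D.isOver
  isOver_opposite := D.isOver_opposite
  isOver_adjacent := D.isOver_adjacent

/-- `D'` is planar isotopic to `D`: some ambient isotopy of the plane carries `D` to `D'`. -/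
def PlanarIsotopic (D D' : CrossingDiagram Q) : Prop :=
  ∃ H : unitInterval → (Plane ≃ₜ Plane),
    Continuous (fun a : unitInterval × Plane => H a.1 a.2) ∧
    H 0 = Homeomorph.refl Plane ∧ D' = D.map (H 1)

end CrossingDiagram

/-! ### The flooding algorithm -/

section Flooding

variable {Q : Type} [Fintype Q]

open Classical in
/-- The tier declared in one round, when `R` is the current collection of inequalities and `A` is
the set of generators that are in earlier tiers: all generators outside `A` whose coefficient is
non-negative in every inequality of `R`. -/
noncomputable def floodTier (R : Set (Q → ℤ)) (A : Finset Q) : Finset Q :=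
  Finset.univ.filter (fun q => q ∉ A ∧ ∀ f ∈ R, 0 ≤ f q)

/-- Remove all inequalities in which some generator of the tier `T` has a positive coefficient. -/
def floodRemove (R : Set (Q → ℤ)) (T : Finset Q) : Set (Q → ℤ) :=
  {f ∈ R | ¬ ∃ q ∈ T, 0 < f q}

open Classical in
/-- The flooding algorithm, started with the inequalities `R` and with the generators in `A` in
earlier tiers. The value `none` means that the algorithm fails; the value `some L` means that it
succeeds, and `L` is then the list of the tiers that it declares, in order. -/
noncomputable def floodFrom (R : Set (Q → ℤ)) (A : Finset Q) : Option (List (Finset Q)) :=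
  if floodTier R A = ∅ then none
  else if floodRemove R (floodTier R A) = ∅ then
    some [floodTier R A, (A ∪ floodTier R A)ᶜ]
  else (floodFrom (floodRemove R (floodTier R A)) (A ∪ floodTier R A)).map
    (fun L => floodTier R A :: L)
termination_by Aᶜ.card
decreasing_by
  rename_i hT _
  obtain ⟨q, hq⟩ := Finset.nonempty_iff_ne_empty.mpr hT
  have hqA : q ∉ A := (Finset.mem_filter.mp hq).2.1
  refine Finset.card_lt_card (Finset.compl_ssubset_compl.mpr ?_)
  refine Finset.ssubset_iff_subset_ne.mpr ⟨Finset.subset_union_left, fun h => hqA ?_⟩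
  rw [h]
  exact Finset.mem_union_right _ hq

/-- The flooding algorithm applied to a diagram. -/
noncomputable def CrossingDiagram.flood (D : CrossingDiagram Q) : Option (List (Finset Q)) :=
  floodFrom D.areaInequalities ∅

end Flooding

/-! ### Front diagrams -/

/-- A generic front diagram in the `(x, z)`-plane. Since a front has no vertical tangents, it is a
union of finitely many strands, each running from a left cusp to a right cusp as the graph of a
function `z = height s x` on `[left s, right s]`, whose slope `y = dz/dx` extends continuously to
the cusps. Each cusp is the common end of exactly two strands, which have the same slope there.
Away from the cusps the only multiple points are transverse double points, and there are finitely
many of these. -/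
structure FrontDiagram where
  n : ℕ
  n_pos : 0 < n
  left : Fin n → ℝ
  right : Fin n → ℝ
  left_lt_right : ∀ s, left s < right s
  height : Fin n → ℝ → ℝ
  height_contDiffOn : ∀ s, ContDiffOn ℝ 1 (height s) (Icc (left s) (right s))
  /-- the other strand at the left cusp of a strand -/
  leftMate : Fin n → Fin n
  leftMate_ne : ∀ s, leftMate s ≠ s
  leftMate_leftMate : ∀ s, leftMate (leftMate s) = s
  left_leftMate : ∀ s, left (leftMate s) = left s
  height_leftMate : ∀ s, height (leftMate s) (left s) = height s (left s)
  slope_leftMate : ∀ s,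
    derivWithin (height (leftMate s)) (Icc (left (leftMate s)) (right (leftMate s))) (left s) =
      derivWithin (height s) (Icc (left s) (right s)) (left s)
  /-- the other strand at the right cusp of a strand -/
  rightMate : Fin n → Fin n
  rightMate_ne : ∀ s, rightMate s ≠ s
  rightMate_rightMate : ∀ s, rightMate (rightMate s) = s
  right_rightMate : ∀ s, right (rightMate s) = right s
  height_rightMate : ∀ s, height (rightMate s) (right s) = height s (right s)
  slope_rightMate : ∀ s,
    derivWithin (height (rightMate s)) (Icc (left (rightMate s)) (right (rightMate s))) (right s) =
      derivWithin (height s) (Icc (left s) (right s)) (right s)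
  /-- two strands meet only in a common cusp or, transversely, in their interiors -/
  meet : ∀ s t x, s ≠ t → x ∈ Icc (left s) (right s) → x ∈ Icc (left t) (right t) →
    height s x = height t x →
      (t = leftMate s ∧ x = left s) ∨ (t = rightMate s ∧ x = right s) ∨
      (x ∈ Ioo (left s) (right s) ∧ x ∈ Ioo (left t) (right t) ∧
        deriv (height s) x ≠ deriv (height t) x)
  /-- there are no triple points -/
  no_triple : ∀ s t u x, s ≠ t → t ≠ u → s ≠ u → x ∈ Icc (left s) (right s) →
    x ∈ Icc (left t) (right t) → x ∈ Icc (left u) (right u) →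
    ¬ (height s x = height t x ∧ height t x = height u x)
  finite_meet : {x : ℝ | ∃ s t, s ≠ t ∧ x ∈ Ioo (left s) (right s) ∧ x ∈ Ioo (left t) (right t) ∧
    height s x = height t x}.Finite

namespace FrontDiagram

variable (Φ : FrontDiagram)

/-- The point `p` lies on the strand `s`. -/
def OnStrand (s : Fin Φ.n) (p : Plane) : Prop :=
  p.1 ∈ Icc (Φ.left s) (Φ.right s) ∧ p.2 = Φ.height s p.1

/-- The front as a subset of the plane. -/
def carrier : Set Plane := {p | ∃ s, Φ.OnStrand s p}

/-- The crossings (transverse double points) of the front. -/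
def crossings : Set Plane :=
  {p | ∃ s t, s ≠ t ∧ p.1 ∈ Ioo (Φ.left s) (Φ.right s) ∧ p.1 ∈ Ioo (Φ.left t) (Φ.right t) ∧
    p.2 = Φ.height s p.1 ∧ p.2 = Φ.height t p.1}

/-- The right cusps of the front. -/
def rightCusps : Set Plane := range (fun s => (Φ.right s, Φ.height s (Φ.right s)))

theorem finite_crossings_union_rightCusps : (Φ.crossings ∪ Φ.rightCusps).Finite := by
  refine Set.Finite.union ?_ (Set.finite_range _)
  have h := (Set.finite_univ (α := Fin Φ.n)).prod Φ.finite_meet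
  refine (h.image (fun a => ((a.2, Φ.height a.1 a.2) : Plane))).subset ?_
  rintro ⟨x, z⟩ ⟨s, t, hst, hs, ht, h1, h2⟩
  exact ⟨(s, x), ⟨Set.mem_univ _, s, t, hst, hs, ht, h1.symm.trans h2⟩,
    Prod.ext rfl h1.symm⟩

/-- The crossings of the resolved diagram: one for each crossing and one for each right cusp of
the front. -/
abbrev Generator : Type := ↥(Φ.crossings ∪ Φ.rightCusps)

noncomputable instance : Fintype Φ.Generator := Φ.finite_crossings_union_rightCusps.fintype

/-- The circle of radius `ρ` that touches the vertical line through `c` at `c` from the right. -/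
def loop (c : Plane) (ρ : ℝ) : Set Plane :=
  {p | (p.1 - (c.1 + ρ)) ^ 2 + (p.2 - c.2) ^ 2 = ρ ^ 2}

/-- The open disc bounded by `loop c ρ`. -/
def loopInterior (c : Plane) (ρ : ℝ) : Set Plane :=
  {p | (p.1 - (c.1 + ρ)) ^ 2 + (p.2 - c.2) ^ 2 < ρ ^ 2}

/-- Radii for the loops at the right cusps that are so small that each closed disc meets the front
in its cusp only and that the closed discs at different cusps are disjoint. -/
def AdmissibleRadii (r : Plane → ℝ) : Prop :=
  (∀ c ∈ Φ.rightCusps, 0 < r c ∧ (loop c (r c) ∪ loopInterior c (r c)) ∩ Φ.carrier = {c}) ∧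
  ∀ c ∈ Φ.rightCusps, ∀ c' ∈ Φ.rightCusps, c ≠ c' →
    Disjoint (loop c (r c) ∪ loopInterior c (r c)) (loop c' (r c') ∪ loopInterior c' (r c'))

/-- The points that lie vertically between two strands of the front passing through `c`. -/
def between (c : Plane) : Set Plane :=
  {p | ∃ s t, Φ.OnStrand s c ∧ Φ.OnStrand t c ∧ Φ.height s p.1 < p.2 ∧ p.2 < Φ.height t p.1}

/-- A set that, near the crossing `c` of the resolved diagram, lies in the east (`0`), north (`1`),
west (`2`) or south (`3`) quadrant. The west quadrant lies between the two strands that arrive at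
`c` from the left. The east quadrant lies between the two strands that leave `c` to the right, and
at a right cusp it is the inside of the loop. The vertical half-lines that start at `c` run in the
north and south quadrants. -/
def quadrantSet (r : Plane → ℝ) (c : Plane) : Fin 4 → Set Plane :=
  ![{p | (c ∈ Φ.crossings ∧ c.1 < p.1 ∧ p ∈ Φ.between c) ∨
        (c ∈ Φ.rightCusps ∧ p ∈ loopInterior c (r c))},
    {p | p.1 = c.1 ∧ c.2 < p.2},
    {p | p.1 < c.1 ∧ p ∈ Φ.between c},
    {p | p.1 = c.1 ∧ p.2 < c.2}]

/-- A model of Ng's resolution of a front. Left cusps are kept as arcs (the corner is rounded by a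
planar isotopy), each crossing of the front stays a crossing, and at each right cusp a small loop
is attached on the right, so that the cusp becomes a crossing: the upper strand runs into the lower
half of the loop and the lower strand into its upper half.

At each crossing the half-strands are, counterclockwise, south-east (`0`), north-east (`1`),
north-west (`2`) and south-west (`3`). The overstrand is the strand of smaller slope; it is the
upper one of the two on the left of the crossing and the lower one on the right, so that it consists
of the half-strands `0` and `2`. -/
def ngModel (r : Plane → ℝ) : CrossingDiagram Φ.Generator where
  carrier := Φ.carrier ∪ ⋃ c ∈ Φ.rightCusps, loop c (r c)
  pos q := q.1
  quadrant q i := 𝓝[Φ.quadrantSet r q.1 i] q.1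
  isOver _ := ![true, false, true, false]
  isOver_opposite _ i := by fin_cases i <;> rfl
  isOver_adjacent _ i := by fin_cases i <;> rfl

/-- `D` is obtained from the front `Φ` by Ng's resolution; as usual for diagrams, this fixes `D`
only up to planar isotopy. -/
def IsNgResolution (D : CrossingDiagram Φ.Generator) : Prop :=
  ∃ r, Φ.AdmissibleRadii r ∧ (Φ.ngModel r).PlanarIsotopic D

end FrontDiagram

/-! ### Components of open sets in the plane -/

/-! A patch that is not the inside of a loop is bounded, so its closure has a rightmost point. That
point must be a crossing of the resolved front, with the patch filling the west quadrant: anywhere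
else the patch could be continued further right, or it would lie inside a loop
(`exists_west_of_isAreaPatch`). In Ng's resolution east and west corners have Reeb sign +1, north
and south corners -1. A patch with a negative corner at a crossing reaches strictly to the right of
that crossing.

Now take any nonempty set of area inequalities, and among the crossings that are rightmost points of
its patches choose one with largest x-coordinate. No patch of the set has a negative corner there,
and one has a positive corner. If all patches of the set are insides of loops, the crossing of any
one of these loops serves instead. This is `exists_generator_of_subset_areaInequalities`.

Flooding therefore never stalls (`exists_floodFrom_eq_some`): the generator found for the remaining
inequalities has a positive coefficient in one of them, whereas generators of earlier tiers have
only non-positive ones, so it is new. Planar isotopy does not change the set of inequalities. -/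

theorem subset_connectedComponentIn_of_isPreconnected {X : Type*} [TopologicalSpace X]
    {F A : Set X} {x p : X} (hA : IsPreconnected A) (hAF : A ⊆ F) (hpA : p ∈ A)
    (hp : p ∈ connectedComponentIn F x) : A ⊆ connectedComponentIn F x := by
  rw [connectedComponentIn_eq hp]
  exact hA.subset_connectedComponentIn hpA hAF

/-- Vertical linear interpolation between the two graphs is continuous and maps `I ×ˢ Ioo 0 1` onto
the region. -/
theorem isPreconnected_regionBetween {I : Set ℝ} (hI : IsPreconnected I) {f g : ℝ → ℝ}
    (hf : ContinuousOn f I) (hg : ContinuousOn g I) (hfg : ∀ x ∈ I, f x < g x) :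
    IsPreconnected {p : Plane | p.1 ∈ I ∧ f p.1 < p.2 ∧ p.2 < g p.1} := by
  have himage : {p : Plane | p.1 ∈ I ∧ f p.1 < p.2 ∧ p.2 < g p.1} =
      (fun a : ℝ × ℝ => ((a.1, f a.1 + a.2 * (g a.1 - f a.1)) : Plane)) '' (I ×ˢ Ioo 0 1) := by
    ext ⟨x, y⟩
    constructor
    · rintro ⟨hx, h1, h2⟩
      simp only at hx h1 h2
      have hpos : 0 < g x - f x := sub_pos.mpr (hfg x hx)
      refine ⟨(x, (y - f x) / (g x - f x)), ⟨hx, div_pos (by linarith) hpos,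
        (div_lt_one hpos).mpr (by linarith)⟩, ?_⟩
      refine Prod.ext rfl ?_
      simp only
      rw [div_mul_cancel₀ _ hpos.ne']
      ring
    · rintro ⟨⟨a, t⟩, ⟨ha, ht0, ht1⟩, heq⟩
      simp only at ha ht0 ht1
      obtain ⟨rfl, rfl⟩ := Prod.mk.inj heq
      have hpos : 0 < g a - f a := sub_pos.mpr (hfg a ha)
      refine ⟨ha, ?_, ?_⟩ <;> simp only <;> nlinarith [mul_pos ht0 hpos]
  rw [himage]
  refine (hI.prod isPreconnected_Ioo).image _ ?_
  have h1 : ContinuousOn (fun a : ℝ × ℝ => f a.1) (I ×ˢ Ioo (0 : ℝ) 1) :=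
    hf.comp continuousOn_fst (fun a ha => ha.1)
  have h2 : ContinuousOn (fun a : ℝ × ℝ => g a.1) (I ×ˢ Ioo (0 : ℝ) 1) :=
    hg.comp continuousOn_fst (fun a ha => ha.1)
  exact continuousOn_fst.prodMk (h1.add (continuousOn_snd.mul (h2.sub h1)))

/-- Near a rightmost point `c` of a component of the complement of a closed set `K`, the component
is separated by `K` from every height `v` with `(c.1, v) ∉ K`. -/
theorem eventually_exists_mem_uIcc_of_rightmost {K : Set Plane} (hK : IsClosed K) {x c : Plane}
    (hmax : ∀ p ∈ connectedComponentIn Kᶜ x, p.1 ≤ c.1) {v : ℝ} (hv : (c.1, v) ∉ K) :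
    ∀ᶠ p : Plane in 𝓝 c, p ∈ connectedComponentIn Kᶜ x →
      ∃ u ∈ uIcc p.2 v, ((p.1, u) : Plane) ∈ K := by
  have hcont : Continuous (fun a : ℝ => ((a, v) : Plane)) := by fun_prop
  have hev : ∀ᶠ a in 𝓝 c.1, ((a, v) : Plane) ∈ Kᶜ :=
    hcont.continuousAt.eventually (hK.isOpen_compl.mem_nhds hv)
  obtain ⟨δ, hδ, hball⟩ := Metric.eventually_nhds_iff_ball.mp hev
  have hfst : ∀ᶠ p : Plane in 𝓝 c, p.1 ∈ Metric.ball c.1 δ :=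
    continuous_fst.continuousAt.eventually (Metric.ball_mem_nhds _ hδ)
  filter_upwards [hfst] with p hp hpP
  -- If the vertical segment from `p` to height `v` missed `K`, the component would contain its end,
  -- then the short horizontal segment at height `v` across the vertical line through `c`, and hence
  -- a point to the right of `c`.
  by_contra! hnot
  have hvert : ((p.1, v) : Plane) ∈ connectedComponentIn Kᶜ x := by
    have hpre : IsPreconnected ((fun u : ℝ => ((p.1, u) : Plane)) '' uIcc p.2 v) :=
      isPreconnected_uIcc.image _ (by fun_prop)
    refine subset_connectedComponentIn_of_isPreconnected hpre ?_ (p := p) ⟨p.2, left_mem_uIcc, rfl⟩ hpP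
      ⟨v, right_mem_uIcc, rfl⟩
    rintro _ ⟨u, hu, rfl⟩
    exact hnot u hu
  have hhor : ((c.1 + δ / 2, v) : Plane) ∈ connectedComponentIn Kᶜ x := by
    have hpre : IsPreconnected ((fun a : ℝ => ((a, v) : Plane)) '' Metric.ball c.1 δ) :=
      (convex_ball c.1 δ).isPreconnected.image _ hcont.continuousOn
    refine subset_connectedComponentIn_of_isPreconnected hpre ?_ ⟨p.1, hp, rfl⟩ hvert
      ⟨c.1 + δ / 2, ?_, rfl⟩
    · rintro _ ⟨a, ha, rfl⟩
      exact hball a ha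
    · rw [Metric.mem_ball, Real.dist_eq, abs_lt]
      constructor <;> linarith
  have := hmax _ hhor
  simp only at this
  linarith

/-- If a rightmost point `c` of a component of the complement of a closed set `K` is an isolated
point of `K` on its vertical line, then points of the component arbitrarily close to `c` have points
of `K` close to `c` above and below them. -/
theorem eventually_between_of_rightmost {K : Set Plane} (hK : IsClosed K) {x c : Plane}
    (hmax : ∀ p ∈ connectedComponentIn Kᶜ x, p.1 ≤ c.1)
    (hc : ∀ᶠ v in 𝓝[≠] c.2, ((c.1, v) : Plane) ∉ K) {U : Set Plane} (hU : U ∈ 𝓝 c) :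
    ∀ᶠ p : Plane in 𝓝 c, p ∈ connectedComponentIn Kᶜ x →
      ∃ u w, u < p.2 ∧ p.2 < w ∧ ((p.1, u) : Plane) ∈ K ∩ U ∧ ((p.1, w) : Plane) ∈ K ∩ U := by
  obtain ⟨ε, hε, hball⟩ := Metric.mem_nhds_iff.mp hU
  rw [eventually_nhdsWithin_iff] at hc
  obtain ⟨η, hη, hvert⟩ := Metric.eventually_nhds_iff_ball.mp hc
  -- Small enough that the heights `c.2 ± d` avoid `K` above `c.1` and that the box of half-width
  -- `d` about `c` stays in `U`.
  set d := min ε η / 2 with hd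
  have hd0 : 0 < d := by positivity
  have hdε : d < ε := by have := min_le_left ε η; have := lt_min hε hη; linarith
  have hdη : d < η := by have := min_le_right ε η; have := lt_min hε hη; linarith
  have hup : ((c.1, c.2 + d) : Plane) ∉ K := by
    refine hvert _ ?_ (by simp [hd0.ne'])
    simpa [Real.dist_eq, abs_of_pos hd0] using hdη
  have hdown : ((c.1, c.2 - d) : Plane) ∉ K := by
    refine hvert _ ?_ (by simp [hd0.ne'])
    simpa [Real.dist_eq, abs_of_pos hd0] using hdη
  filter_upwards [eventually_exists_mem_uIcc_of_rightmost hK hmax hup,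
    eventually_exists_mem_uIcc_of_rightmost hK hmax hdown, Metric.ball_mem_nhds c hd0]
    with p hpup hpdown hpd hpP
  have hpK : p ∉ K := connectedComponentIn_subset _ _ hpP
  rw [Metric.mem_ball, Prod.dist_eq, max_lt_iff, Real.dist_eq, Real.dist_eq, abs_lt, abs_lt] at hpd
  obtain ⟨w, hw, hwK⟩ := hpup hpP
  obtain ⟨u, hu, huK⟩ := hpdown hpP
  rw [uIcc_of_le (by linarith)] at hw
  rw [uIcc_of_ge (by linarith)] at hu
  have hmem : ∀ y, c.2 - d ≤ y → y ≤ c.2 + d → ((p.1, y) : Plane) ∈ U := by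
    intro y h1 h2
    apply hball
    rw [Metric.mem_ball, Prod.dist_eq, max_lt_iff, Real.dist_eq, Real.dist_eq, abs_lt, abs_lt]
    refine ⟨⟨?_, ?_⟩, ?_, ?_⟩ <;> simp only <;> linarith
  refine ⟨u, w, lt_of_le_of_ne hu.2 ?_, lt_of_le_of_ne hw.1 ?_,
    ⟨huK, hmem u hu.1 (by linarith [hu.2])⟩, hwK, hmem w (by linarith [hw.1]) hw.2⟩
  · rintro rfl
    exact hpK huK
  · rintro rfl
    exact hpK hwK

/-! ### Invariance under planar isotopy -/

namespace CrossingDiagram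

variable {Q : Type}

theorem IsAreaPatch.isOpen {D : CrossingDiagram Q} (hD : IsClosed D.carrier) {P : Set Plane}
    (hP : D.IsAreaPatch P) : IsOpen P := by
  obtain ⟨⟨p, -, rfl⟩, -⟩ := hP
  exact hD.isOpen_compl.connectedComponentIn

theorem IsAreaPatch.image {D : CrossingDiagram Q} {P : Set Plane} (hP : D.IsAreaPatch P)
    (h : Plane ≃ₜ Plane) : (D.map h).IsAreaPatch (h '' P) := by
  obtain ⟨⟨p, hp, rfl⟩, hb⟩ := hP
  have hcompl : (D.map h).carrierᶜ = h '' D.carrierᶜ := (image_compl_eq h.bijective).symm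
  refine ⟨⟨h p, hcompl ▸ mem_image_of_mem h hp, ?_⟩, ?_⟩
  · rw [hcompl, h.image_connectedComponentIn hp]
  -- Boundedness is not a topological notion; it is carried over through compactness of the closure.
  · exact (hb.isCompact_closure.image h.continuous).isBounded.subset (image_mono subset_closure)

/-- Quadrant filters are pushed forward along `h` and the over/under data stay fixed, so every
corner keeps its sign. -/
theorem areaCoeff_map (D : CrossingDiagram Q) (h : Plane ≃ₜ Plane) (P : Set Plane) :
    (D.map h).areaCoeff (h '' P) = D.areaCoeff P := by
  funext q
  unfold areaCoeff
  refine Finset.sum_congr rfl fun i _ => ?_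
  have hmem : h '' P ∈ (D.map h).quadrant q i ↔ P ∈ D.quadrant q i := by
    change h ⁻¹' (h '' P) ∈ D.quadrant q i ↔ _
    rw [preimage_image_eq _ h.injective]
  by_cases hP : P ∈ D.quadrant q i
  · rw [if_pos hP, if_pos (hmem.mpr hP)]
    rfl
  · rw [if_neg hP, if_neg (mt hmem.mp hP)]

theorem areaInequalities_map_subset (D : CrossingDiagram Q) (h : Plane ≃ₜ Plane) :
    (D.map h).areaInequalities ⊆ D.areaInequalities := by
  rintro f ⟨P, hP, rfl⟩
  have hback : (D.map h).map h.symm = D := by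
    cases D
    simp [CrossingDiagram.map, image_image, Filter.map_map, Function.comp_def]
  have hP' := hP.image h.symm
  rw [hback] at hP'
  refine ⟨h.symm '' P, hP', ?_⟩
  conv_rhs => rw [← hback]
  rw [areaCoeff_map]

theorem map_areaInequalities (D : CrossingDiagram Q) (h : Plane ≃ₜ Plane) :
    D.areaInequalities ⊆ (D.map h).areaInequalities := by
  rintro f ⟨P, hP, rfl⟩
  exact ⟨h '' P, hP.image h, (areaCoeff_map D h P).symm⟩

end CrossingDiagram

/-! ### The flooding algorithm -/

section Flooding

variable {Q : Type} [Fintype Q]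

/-- Flooding succeeds, and partitions the remaining generators into tiers, if every nonempty
subset of the inequalities has a generator with non-negative coefficients, not all zero. -/
theorem exists_floodFrom_eq_some (R : Set (Q → ℤ)) (A : Finset Q) (hne : R.Nonempty)
    (hR : ∀ S ⊆ R, S.Nonempty → ∃ q, (∀ f ∈ S, 0 ≤ f q) ∧ ∃ f ∈ S, 0 < f q)
    (hA : ∀ f ∈ R, ∀ q ∈ A, f q ≤ 0) :
    ∃ L, floodFrom R A = some L ∧ (∀ q ∉ A, ∃! k : Fin L.length, q ∈ L.get k) ∧
      ∀ q ∈ A, ∀ k : Fin L.length, q ∉ L.get k := by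
  classical
  induction R, A using floodFrom.induct with
  | case1 R A hT =>
    -- By `hA` a generator with a positive coefficient is not in an earlier tier, so the tier cannot
    -- be empty.
    obtain ⟨q, hq, f, hf, hfq⟩ := hR R Subset.rfl hne
    have hmem : q ∈ floodTier R A :=
      Finset.mem_filter.mpr ⟨Finset.mem_univ q, fun hqA => (hA f hf q hqA).not_gt hfq, hq⟩
    rw [hT] at hmem
    exact absurd hmem (Finset.notMem_empty q)
  | case2 R A hT hR' =>
    have hTA : ∀ q ∈ floodTier R A, q ∉ A := fun q hq => (Finset.mem_filter.mp hq).2.1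
    refine ⟨[floodTier R A, (A ∪ floodTier R A)ᶜ], ?_, fun q hq => ?_, fun q hq k => ?_⟩
    · rw [floodFrom, if_neg hT, if_pos hR']
    · by_cases hqT : q ∈ floodTier R A
      · refine ⟨⟨0, by simp⟩, by simpa using hqT, fun k hk => ?_⟩
        fin_cases k
        · rfl
        · simp [hqT] at hk
      · refine ⟨⟨1, by simp⟩, by simp [hqT, hq], fun k hk => ?_⟩
        fin_cases k
        · exact absurd (by simpa using hk) hqT
        · rfl
    · fin_cases k
      · simpa using fun h => hTA q h hq
      · simp [hq]
  | case3 R A hT hR' ih =>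
    have hTA : ∀ q ∈ floodTier R A, q ∉ A := fun q hq => (Finset.mem_filter.mp hq).2.1
    -- The invariant `hA` survives the round: an inequality that is not removed has no positive
    -- coefficient at the new tier.
    obtain ⟨L, hL, hout, hin⟩ := ih (nonempty_iff_ne_empty.mpr hR')
      (fun S hS => hR S (hS.trans (sep_subset _ _))) (fun f hf q hq => by
        rcases Finset.mem_union.mp hq with h | h
        · exact hA f hf.1 q h
        · exact not_lt.mp fun hlt => hf.2 ⟨q, h, hlt⟩)
    refine ⟨floodTier R A :: L, ?_, fun q hq => ?_, fun q hq k => ?_⟩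
    · rw [floodFrom, if_neg hT, if_neg hR']
      convert congrArg (Option.map (fun L => floodTier R A :: L)) hL
      rfl
    · by_cases hqT : q ∈ floodTier R A
      · refine ⟨⟨0, by simp⟩, by simpa using hqT, fun k => ?_⟩
        refine Fin.cases (fun _ => rfl) (fun k hk => ?_) k
        exact absurd hk (hin q (Finset.mem_union_right _ hqT) k)
      · obtain ⟨k, hk, huniq⟩ := hout q (by simp [hq, hqT])
        refine ⟨k.succ, hk, fun j => ?_⟩
        refine Fin.cases (fun hj => absurd hj hqT) (fun j hj => ?_) j
        exact congrArg Fin.succ (huniq j hj)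
    · refine Fin.cases (fun h => hTA q h hq) (fun k => ?_) k
      exact hin q (Finset.mem_union_left _ hq) k

end Flooding

/-! ### The local structure of the resolved front -/

namespace FrontDiagram

variable (Φ : FrontDiagram)

theorem isClosed_setOf_onStrand (s : Fin Φ.n) : IsClosed {p | Φ.OnStrand s p} := by
  have himage : {p | Φ.OnStrand s p} =
      (fun x => ((x, Φ.height s x) : Plane)) '' Icc (Φ.left s) (Φ.right s) := by
    ext ⟨x, z⟩
    constructor
    · rintro ⟨hx, hz⟩
      exact ⟨x, hx, Prod.ext rfl hz.symm⟩
    · rintro ⟨a, ha, heq⟩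
      obtain ⟨rfl, rfl⟩ := Prod.mk.inj heq
      exact ⟨ha, rfl⟩
  rw [himage]
  exact (isCompact_Icc.image_of_continuousOn
    (continuousOn_id.prodMk (Φ.height_contDiffOn s).continuousOn)).isClosed

theorem isClosed_carrier : IsClosed Φ.carrier := by
  have : Φ.carrier = ⋃ s, {p | Φ.OnStrand s p} := by ext; simp [carrier]
  rw [this]
  exact isClosed_iUnion_of_finite Φ.isClosed_setOf_onStrand

theorem isClosed_loop (c : Plane) (ρ : ℝ) : IsClosed (loop c ρ) :=
  isClosed_eq (by fun_prop) (by fun_prop)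

theorem isOpen_loopInterior (c : Plane) (ρ : ℝ) : IsOpen (loopInterior c ρ) :=
  isOpen_lt (by fun_prop) (by fun_prop)

/-- `Plane` carries the sup metric, so this disc is not a metric ball. Convexity of the squared
Euclidean distance is checked by hand, with defect `a * (1 - a)` times the squared distance of the
two points. -/
theorem convex_loopInterior (c : Plane) (ρ : ℝ) : Convex ℝ (loopInterior c ρ) := by
  intro p hp q hq a b ha hb hab
  obtain rfl : b = 1 - a := by linarith
  simp only [loopInterior, mem_ofPred_eq, Prod.fst_add, Prod.smul_fst, Prod.snd_add, Prod.smul_snd,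
    smul_eq_mul] at hp hq ⊢
  set M := max ((p.1 - (c.1 + ρ)) ^ 2 + (p.2 - c.2) ^ 2) ((q.1 - (c.1 + ρ)) ^ 2 + (q.2 - c.2) ^ 2)
  refine lt_of_le_of_lt ?_ (max_lt hp hq : M < ρ ^ 2)
  have h1 := mul_le_mul_of_nonneg_left (le_max_left _ _ :
    (p.1 - (c.1 + ρ)) ^ 2 + (p.2 - c.2) ^ 2 ≤ M) ha
  have h2 := mul_le_mul_of_nonneg_left (le_max_right _ _ :
    (q.1 - (c.1 + ρ)) ^ 2 + (q.2 - c.2) ^ 2 ≤ M) hb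
  have h3 : 0 ≤ a * (1 - a) * ((p.1 - q.1) ^ 2 + (p.2 - q.2) ^ 2) := by positivity
  nlinarith

theorem finite_rightCusps : Φ.rightCusps.Finite := Set.finite_range _

variable {Φ}

theorem isClosed_iUnion_loop {C : Set Plane} (hC : C ⊆ Φ.rightCusps) (r : Plane → ℝ) :
    IsClosed (⋃ c ∈ C, loop c (r c)) :=
  (Φ.finite_rightCusps.subset hC).isClosed_biUnion fun c _ => isClosed_loop c (r c)

theorem isClosed_ngModel_carrier (r : Plane → ℝ) : IsClosed (Φ.ngModel r).carrier :=
  Φ.isClosed_carrier.union (isClosed_iUnion_loop Subset.rfl r)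

theorem eq_of_mem_loop {c p : Plane} {ρ : ℝ} (hρ : 0 < ρ) (hp : p ∈ loop c ρ)
    (hpc : p.1 ≤ c.1) : p = c := by
  have heq : (p.1 - (c.1 + ρ)) ^ 2 + (p.2 - c.2) ^ 2 = ρ ^ 2 := hp
  have h1 : p.1 = c.1 := by nlinarith [sq_nonneg (p.2 - c.2)]
  rw [h1] at heq
  have h2 : (p.2 - c.2) ^ 2 = 0 := by nlinarith
  exact Prod.ext h1 (sub_eq_zero.mp (pow_eq_zero_iff two_ne_zero |>.mp h2))

theorem mem_loopInterior_of_between {c : Plane} {ρ x u y w : ℝ} (hu : ((x, u) : Plane) ∈ loop c ρ)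
    (hw : ((x, w) : Plane) ∈ loop c ρ) (huy : u < y) (hyw : y < w) :
    ((x, y) : Plane) ∈ loopInterior c ρ := by
  simp only [loop, loopInterior, mem_ofPred_eq] at hu hw ⊢
  -- Subtracting the two circle equations shows that a vertical chord is symmetric about height
  -- `c.2`.
  have h : (w - u) * (u + w - 2 * c.2) = 0 := by linarith
  have hsum : u + w - 2 * c.2 = 0 :=
    (mul_eq_zero.mp h).resolve_left (sub_ne_zero.mpr (huy.trans hyw).ne')
  obtain rfl : w = 2 * c.2 - u := by linarith
  nlinarith [mul_pos (sub_pos.mpr huy) (sub_pos.mpr hyw)]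

theorem rightCusps_subset_carrier : Φ.rightCusps ⊆ Φ.carrier := by
  rintro _ ⟨s, rfl⟩
  exact ⟨s, right_mem_Icc.mpr (Φ.left_lt_right s).le, rfl⟩

theorem eq_or_eq_of_onStrand {c : Plane} {s t u : Fin Φ.n} (hst : s ≠ t) (hs : Φ.OnStrand s c)
    (ht : Φ.OnStrand t c) (hu : Φ.OnStrand u c) : u = s ∨ u = t := by
  by_contra! h
  exact Φ.no_triple s t u c.1 hst h.2.symm h.1.symm hs.1 ht.1 hu.1
    ⟨hs.2.symm.trans ht.2, ht.2.symm.trans hu.2⟩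

/-- Without triple points, only `t` and `rightMate t` pass through the cusp, and both end there. -/
theorem right_eq_of_mem_rightCusps {c : Plane} (hc : c ∈ Φ.rightCusps) {s : Fin Φ.n}
    (hs : Φ.OnStrand s c) : Φ.right s = c.1 := by
  obtain ⟨t, rfl⟩ := hc
  have ht : Φ.OnStrand t (Φ.right t, Φ.height t (Φ.right t)) :=
    ⟨right_mem_Icc.mpr (Φ.left_lt_right t).le, rfl⟩
  have ht' : Φ.OnStrand (Φ.rightMate t) (Φ.right t, Φ.height t (Φ.right t)) := by
    refine ⟨?_, (Φ.height_rightMate t).symm⟩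
    have := right_mem_Icc.mpr (Φ.left_lt_right (Φ.rightMate t)).le
    rwa [Φ.right_rightMate t] at this ⊢
  rcases eq_or_eq_of_onStrand (Φ.rightMate_ne t).symm ht ht' hs with rfl | rfl
  · rfl
  · exact Φ.right_rightMate t

theorem disjoint_crossings_rightCusps : Disjoint Φ.crossings Φ.rightCusps := by
  rw [Set.disjoint_left]
  rintro c ⟨s, t, -, hs, -, hcs, -⟩ hc
  exact hs.2.ne (right_eq_of_mem_rightCusps hc ⟨Ioo_subset_Icc_self hs, hcs⟩).symm

theorem eventually_onStrand (c : Plane) :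
    ∀ᶠ p in 𝓝 c, ∀ s, Φ.OnStrand s p → Φ.OnStrand s c := by
  rw [eventually_all]
  intro s
  by_cases hs : Φ.OnStrand s c
  · exact Eventually.of_forall fun _ _ => hs
  · filter_upwards [(Φ.isClosed_setOf_onStrand s).isOpen_compl.mem_nhds hs] with p hp h
    exact absurd h hp

/-- Near a point `c` of the front, the part of the resolved front that is not to the right of `c`
lies on strands through `c`. -/
theorem eventually_exists_onStrand {r : Plane → ℝ} (hr : Φ.AdmissibleRadii r) {c : Plane}
    (hc : c ∈ Φ.carrier) :
    ∀ᶠ p in 𝓝 c, p ∈ (Φ.ngModel r).carrier → p.1 ≤ c.1 →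
      ∃ s, Φ.OnStrand s c ∧ Φ.OnStrand s p := by
  -- The loop at another cusp meets the front only in that cusp, so it misses `c`.
  have hnot : c ∉ ⋃ c' ∈ Φ.rightCusps \ {c}, loop c' (r c') := by
    simp only [mem_iUnion, not_exists]
    intro c' hc' hmem
    have : c ∈ ({c'} : Set Plane) := (hr.1 c' hc'.1).2 ▸ ⟨Or.inl hmem, hc⟩
    exact hc'.2 (mem_singleton_iff.mp this).symm
  filter_upwards [eventually_onStrand (Φ := Φ) c,
    (isClosed_iUnion_loop sdiff_subset r).isOpen_compl.mem_nhds hnot] with p hp hloop hpK hpc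
  rcases hpK with ⟨s, hs⟩ | hpl
  · exact ⟨s, hp s hs, hs⟩
  · obtain ⟨c', hc', hpc'⟩ := mem_iUnion₂.mp hpl
    by_cases h : c' = c
    · subst h
      obtain rfl := eq_of_mem_loop (hr.1 _ hc').1 hpc' hpc
      obtain ⟨s, hs⟩ := hc
      exact ⟨s, hs, hs⟩
    · exact absurd (mem_iUnion₂.mpr ⟨c', ⟨hc', h⟩, hpc'⟩) hloop

theorem loopInterior_subset_compl {r : Plane → ℝ} (hr : Φ.AdmissibleRadii r) {c : Plane}
    (hc : c ∈ Φ.rightCusps) : loopInterior c (r c) ⊆ (Φ.ngModel r).carrierᶜ := by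
  rintro p hp (hpΦ | hpl)
  · have : p ∈ ({c} : Set Plane) := (hr.1 c hc).2 ▸ ⟨Or.inr hp, hpΦ⟩
    obtain rfl := mem_singleton_iff.mp this
    simp [loopInterior] at hp
  · obtain ⟨c', hc', hpc'⟩ := mem_iUnion₂.mp hpl
    by_cases h : c = c'
    · subst h
      exact ne_of_lt hp hpc'
    · exact Set.disjoint_left.mp (hr.2 c hc c' hc' h) (Or.inr hp) (Or.inl hpc')

/-- A component that meets the inside of a loop is the inside of this loop. -/
theorem connectedComponentIn_eq_loopInterior {r : Plane → ℝ} (hr : Φ.AdmissibleRadii r)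
    {x c : Plane} (hc : c ∈ Φ.rightCusps)
    (hmeet : ¬ Disjoint (connectedComponentIn (Φ.ngModel r).carrierᶜ x) (loopInterior c (r c))) :
    connectedComponentIn (Φ.ngModel r).carrierᶜ x = loopInterior c (r c) := by
  obtain ⟨p, hpP, hpc⟩ := Set.not_disjoint_iff.mp hmeet
  apply Subset.antisymm
  · have hopen : IsOpen {p : Plane | r c ^ 2 < (p.1 - (c.1 + r c)) ^ 2 + (p.2 - c.2) ^ 2} :=
      isOpen_lt (by fun_prop) (by fun_prop)
    refine isPreconnected_connectedComponentIn.subset_left_of_subset_union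
      (isOpen_loopInterior c (r c)) hopen ?_ ?_ ⟨p, hpP, hpc⟩
    · refine Set.disjoint_left.mpr fun y h1 h2 => ?_
      rw [loopInterior, mem_ofPred_eq] at h1
      exact lt_asymm h1 h2
    · intro y hy
      have hyK : y ∉ loop c (r c) := fun h =>
        connectedComponentIn_subset _ _ hy (Or.inr (mem_iUnion₂.mpr ⟨c, hc, h⟩))
      exact lt_or_gt_of_ne hyK
  · exact subset_connectedComponentIn_of_isPreconnected
      (convex_loopInterior c (r c)).isPreconnected
      (loopInterior_subset_compl hr hc) hpc hpP

/-! ### Rightmost points of patches -/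

/-- On a small interval to the left of a common point, one of two strands is above the other. -/
theorem exists_Ioo_height_lt {c : Plane} {s t : Fin Φ.n} (hst : s ≠ t) (hs : Φ.OnStrand s c)
    (ht : Φ.OnStrand t c) (hls : Φ.left s < c.1) (hlt : Φ.left t < c.1) :
    ∃ l < c.1, (∀ x ∈ Ioo l c.1, Φ.height s x < Φ.height t x) ∨
      ∀ x ∈ Ioo l c.1, Φ.height t x < Φ.height s x := by
  have hfin : ∀ᶠ x in 𝓝[<] c.1, x ∉ {x : ℝ | ∃ s t, s ≠ t ∧ x ∈ Ioo (Φ.left s) (Φ.right s) ∧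
      x ∈ Ioo (Φ.left t) (Φ.right t) ∧ Φ.height s x = Φ.height t x} := by
    -- `c.1` itself may be the abscissa of a crossing; the other abscissas form a finite, hence
    -- closed, set.
    have hdiff := (Φ.finite_meet.subset (sdiff_subset (t := {c.1}))).isClosed.isOpen_compl.mem_nhds
      (x := c.1) (by simp)
    filter_upwards [mem_nhdsWithin_of_mem_nhds hdiff, self_mem_nhdsWithin] with x hx hlt hmem
    exact hx ⟨hmem, ne_of_lt hlt⟩
  obtain ⟨l, hl, hsub⟩ := (mem_nhdsLT_iff_exists_Ioo_subset).mp
    (inter_mem hfin (inter_mem (Ioo_mem_nhdsLT hls) (Ioo_mem_nhdsLT hlt)))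
  refine ⟨l, hl, ?_⟩
  have hIs : Ioo l c.1 ⊆ Ioo (Φ.left s) (Φ.right s) := fun x hx =>
    ⟨(hsub hx).2.1.1, hx.2.trans_le hs.1.2⟩
  have hIt : Ioo l c.1 ⊆ Ioo (Φ.left t) (Φ.right t) := fun x hx =>
    ⟨(hsub hx).2.2.1, hx.2.trans_le ht.1.2⟩
  have hne : ∀ x ∈ Ioo l c.1, Φ.height s x ≠ Φ.height t x := fun x hx heq =>
    (hsub hx).1 ⟨s, t, hst, hIs hx, hIt hx, heq⟩
  have hcs : ContinuousOn (Φ.height s) (Ioo l c.1) :=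
    (Φ.height_contDiffOn s).continuousOn.mono (hIs.trans Ioo_subset_Icc_self)
  have hct : ContinuousOn (Φ.height t) (Ioo l c.1) :=
    (Φ.height_contDiffOn t).continuousOn.mono (hIt.trans Ioo_subset_Icc_self)
  by_contra! h
  obtain ⟨⟨x, hx, hxle⟩, y, hy, hyle⟩ := h
  obtain ⟨z, hz, heq⟩ := isPreconnected_Ioo.intermediate_value₂ hx hy hct hcs hxle hyle
  exact hne z hz heq.symm

theorem eventually_mem_of_onStrand {c : Plane} {s : Fin Φ.n} (hs : Φ.OnStrand s c)
    (hls : Φ.left s < c.1) {U : Set Plane} (hU : U ∈ 𝓝 c) :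
    ∀ᶠ x in 𝓝[<] c.1, x ∈ Icc (Φ.left s) (Φ.right s) ∧ ((x, Φ.height s x) : Plane) ∈ U := by
  have hIcc : ∀ᶠ x in 𝓝[<] c.1, x ∈ Icc (Φ.left s) (Φ.right s) := by
    filter_upwards [Ioo_mem_nhdsLT hls] with x hx
    exact ⟨hx.1.le, hx.2.le.trans hs.1.2⟩
  have hcont := (Φ.height_contDiffOn s).continuousOn c.1 hs.1
  have htend : Tendsto (fun x => ((x, Φ.height s x) : Plane))
      (𝓝[Icc (Φ.left s) (Φ.right s)] c.1) (𝓝 (c.1, Φ.height s c.1)) :=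
    (continuousWithinAt_id.prodMk hcont)
  rw [← hs.2] at htend
  have hle : 𝓝[<] c.1 ≤ 𝓝[Icc (Φ.left s) (Φ.right s)] c.1 :=
    le_inf nhdsWithin_le_nhds (le_principal_iff.mpr hIcc)
  exact hIcc.and (hle (htend hU))

/-- A component that has points arbitrarily close to `c` between the two strands arriving at `c`
from the left occupies the west quadrant of `c`. -/
theorem mem_west_of_frequently {r : Plane → ℝ} (hr : Φ.AdmissibleRadii r) {x c : Plane}
    {s t : Fin Φ.n} (hst : s ≠ t) (hs : Φ.OnStrand s c) (ht : Φ.OnStrand t c)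
    (hls : Φ.left s < c.1) (hlt : Φ.left t < c.1)
    (hfreq : ∃ᶠ p in 𝓝 c, p ∈ connectedComponentIn (Φ.ngModel r).carrierᶜ x ∧
      p ∈ Φ.quadrantSet r c 2) :
    connectedComponentIn (Φ.ngModel r).carrierᶜ x ∈ 𝓝[Φ.quadrantSet r c 2] c := by
  obtain ⟨l₀, hl₀, hlt₀⟩ := exists_Ioo_height_lt hst hs ht hls hlt
  wlog hord : ∀ x ∈ Ioo l₀ c.1, Φ.height s x < Φ.height t x generalizing s t
  · exact this hst.symm ht hs hlt hls hlt₀.symm (hlt₀.resolve_left hord)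
  obtain ⟨ε, hε, hball⟩ := Metric.eventually_nhds_iff_ball.mp
    (eventually_exists_onStrand hr ⟨s, hs⟩)
  have hU : Metric.ball c ε ∈ 𝓝 c := Metric.ball_mem_nhds c hε
  obtain ⟨l, hl, hsub⟩ := mem_nhdsLT_iff_exists_Ioo_subset.mp
    ((eventually_mem_of_onStrand hs hls hU).and ((eventually_mem_of_onStrand ht hlt hU).and
      (Ioo_mem_nhdsLT hl₀)) : _ ∈ _)
  have hlt' : ∀ x ∈ Ioo l c.1, Φ.height s x < Φ.height t x := fun x hx => hord x (hsub hx).2.2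
  -- The wedge between the two strands just left of `c`. Both graphs run in a ball about `c` (a box,
  -- for the sup metric), so the wedge does too; there the diagram consists of strands through `c`,
  -- which are `s` and `t` only. Hence the wedge misses the diagram.
  set V : Set Plane := {p | p.1 ∈ Ioo l c.1 ∧ Φ.height s p.1 < p.2 ∧ p.2 < Φ.height t p.1}
  have hVpre : IsPreconnected V := isPreconnected_regionBetween isPreconnected_Ioo
    ((Φ.height_contDiffOn s).continuousOn.mono fun x hx => (hsub hx).1.1)
    ((Φ.height_contDiffOn t).continuousOn.mono fun x hx => (hsub hx).2.1.1) hlt'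
  have hVK : V ⊆ (Φ.ngModel r).carrierᶜ := by
    rintro p ⟨hp, hsp, hpt⟩ hpK
    have h1 := (hsub hp).1.2
    have h2 := (hsub hp).2.1.2
    rw [Metric.mem_ball, Prod.dist_eq, max_lt_iff, Real.dist_eq, Real.dist_eq, abs_lt, abs_lt]
      at h1 h2
    have hpball : p ∈ Metric.ball c ε := by
      rw [Metric.mem_ball, Prod.dist_eq, max_lt_iff, Real.dist_eq, Real.dist_eq, abs_lt, abs_lt]
      exact ⟨h1.1, by linarith [h1.2.1], by linarith [h2.2.2]⟩
    obtain ⟨u, huc, hup⟩ := hball p hpball hpK hp.2.le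
    rcases eq_or_eq_of_onStrand hst hs ht huc with rfl | rfl
    · exact hsp.ne hup.2.symm
    · exact hpt.ne hup.2
  have hquad : ∀ p : Plane, l < p.1 → p ∈ Φ.quadrantSet r c 2 → p ∈ V := by
    rintro p hlp ⟨hpc, s', t', hs', ht', hlow, hupp⟩
    have h0 := hlt' p.1 ⟨hlp, hpc⟩
    rcases eq_or_eq_of_onStrand hst hs ht hs' with rfl | rfl <;>
      rcases eq_or_eq_of_onStrand hst hs ht ht' with rfl | rfl
    · exact absurd (hlow.trans hupp) (lt_irrefl _)
    · exact ⟨⟨hlp, hpc⟩, hlow, hupp⟩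
    · exact absurd (hlow.trans hupp) h0.not_gt
    · exact absurd (hlow.trans hupp) (lt_irrefl _)
  have hnear : ∀ᶠ p : Plane in 𝓝 c, l < p.1 :=
    continuous_fst.continuousAt.eventually (lt_mem_nhds hl)
  obtain ⟨p, ⟨hpP, hpq⟩, hpl⟩ := (hfreq.and_eventually hnear).exists
  have hVP := subset_connectedComponentIn_of_isPreconnected hVpre hVK (hquad p hpl hpq) hpP
  rw [mem_nhdsWithin_iff_eventually]
  filter_upwards [hnear] with p' hp' hq'
  exact hVP (hquad p' hp' hq')

/-- A patch that is not the inside of a loop has a rightmost point at a crossing of the resolved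
front, where it occupies the west quadrant. -/
theorem exists_west_of_isAreaPatch {r : Plane → ℝ} (hr : Φ.AdmissibleRadii r) {P : Set Plane}
    (hP : (Φ.ngModel r).IsAreaPatch P)
    (hloop : ∀ c ∈ Φ.rightCusps, Disjoint P (loopInterior c (r c))) :
    ∃ q : Φ.Generator, P ∈ (Φ.ngModel r).quadrant q 2 ∧ ∀ p ∈ P, p.1 ≤ q.1.1 := by
  have hK := isClosed_ngModel_carrier (Φ := Φ) r
  obtain ⟨⟨x, hx, rfl⟩, hbdd⟩ := hP
  obtain ⟨c, hcP, hcmax⟩ := hbdd.isCompact_closure.exists_isMaxOn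
    ⟨x, subset_closure (mem_connectedComponentIn hx)⟩ continuous_fst.continuousOn
  have hmax : ∀ p ∈ connectedComponentIn (Φ.ngModel r).carrierᶜ x, p.1 ≤ c.1 :=
    fun p hp => hcmax (subset_closure hp)
  have hfreq := mem_closure_iff_frequently.mp hcP
  have hline : Continuous (fun v : ℝ => ((c.1, v) : Plane)) := by fun_prop
  have hvert : ∀ {p : Plane → Prop}, (∀ᶠ y in 𝓝 c, p y) → ∀ᶠ v in 𝓝[≠] c.2, p (c.1, v) :=
    fun h => (hline.tendsto c.2 |>.mono_left nhdsWithin_le_nhds).eventually h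
  by_cases hcΦ : c ∈ Φ.carrier
  · have hstrand := eventually_exists_onStrand hr hcΦ
    -- Strands are graphs, so each strand through `c` meets the vertical line in `c` alone.
    have hc : ∀ᶠ v in 𝓝[≠] c.2, ((c.1, v) : Plane) ∉ (Φ.ngModel r).carrier := by
      filter_upwards [hvert hstrand, self_mem_nhdsWithin] with v hv hne hmem
      obtain ⟨s, hs, hs'⟩ := hv hmem le_rfl
      exact hne (hs'.2.trans hs.2.symm)
    have hbetween : ∀ᶠ p in 𝓝 c, p ∈ connectedComponentIn (Φ.ngModel r).carrierᶜ x →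
        p.1 < c.1 ∧ ∃ s t, s ≠ t ∧ Φ.OnStrand s c ∧ Φ.OnStrand t c ∧
          Φ.OnStrand s (p.1, Φ.height s p.1) ∧ Φ.OnStrand t (p.1, Φ.height t p.1) ∧
          Φ.height s p.1 < p.2 ∧ p.2 < Φ.height t p.1 := by
      filter_upwards [eventually_between_of_rightmost hK hmax hc hstrand] with p hp hpP
      obtain ⟨u, w, hup, hpw, ⟨huK, huU⟩, hwK, hwU⟩ := hp hpP
      obtain ⟨s, hsc, hsp⟩ := huU huK (hmax p hpP)
      obtain ⟨t, htc, htp⟩ := hwU hwK (hmax p hpP)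
      obtain rfl : u = Φ.height s p.1 := hsp.2
      obtain rfl : w = Φ.height t p.1 := htp.2
      refine ⟨lt_of_le_of_ne (hmax p hpP) fun heq => ?_, s, t, ?_, hsc, htc, hsp, htp, hup, hpw⟩
      · have h1 := hsc.2
        have h2 := htc.2
        rw [← heq] at h1 h2
        linarith
      · rintro rfl
        linarith
    obtain ⟨p, hpP, hp⟩ := (hfreq.and_eventually hbetween).exists
    obtain ⟨hpc, s, t, hst, hs, ht, hsp, htp, -, -⟩ := hp hpP
    have hls : Φ.left s < c.1 := hsp.1.1.trans_lt hpc
    have hlt : Φ.left t < c.1 := htp.1.1.trans_lt hpc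
    -- Both strands arrive from the left, which rules out a left cusp.
    have hgen : c ∈ Φ.crossings ∪ Φ.rightCusps := by
      rcases Φ.meet s t c.1 hst hs.1 ht.1 (hs.2.symm.trans ht.2) with ⟨-, h⟩ | ⟨-, h⟩ | ⟨h1, h2, -⟩
      · exact absurd h hls.ne'
      · exact Or.inr ⟨s, Prod.ext h.symm (by simp only [← h, hs.2])⟩
      · exact Or.inl ⟨s, t, hst, h1, h2, hs.2, ht.2⟩
    refine ⟨⟨c, hgen⟩, ?_, hmax⟩
    refine mem_west_of_frequently hr hst hs ht hls hlt ?_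
    refine (hfreq.and_eventually hbetween).mono fun p ⟨hpP, hp⟩ => ⟨hpP, ?_⟩
    obtain ⟨hpc, s, t, -, hs, ht, -, -, h1, h2⟩ := hp hpP
    exact ⟨hpc, s, t, hs, ht, h1, h2⟩
  · exfalso
    by_cases hcK : c ∈ (Φ.ngModel r).carrier
    · obtain ⟨c₀, hc₀, hcl⟩ := mem_iUnion₂.mp (hcK.resolve_left hcΦ)
      have hnot : c ∉ ⋃ c' ∈ Φ.rightCusps \ {c₀}, loop c' (r c') := by
        simp only [mem_iUnion, not_exists]
        intro c' hc' hmem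
        exact Set.disjoint_left.mp (hr.2 c₀ hc₀ c' hc'.1 (Ne.symm hc'.2)) (Or.inl hcl) (Or.inl hmem)
      have hU : ∀ᶠ p in 𝓝 c, p ∈ (Φ.ngModel r).carrier → p ∈ loop c₀ (r c₀) := by
        filter_upwards [Φ.isClosed_carrier.isOpen_compl.mem_nhds hcΦ,
          (isClosed_iUnion_loop sdiff_subset r).isOpen_compl.mem_nhds hnot] with p h1 h2 hpK
        obtain ⟨c', hc', hpc'⟩ := mem_iUnion₂.mp (hpK.resolve_left h1)
        by_cases h : c' = c₀
        · exact h ▸ hpc'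
        · exact absurd (mem_iUnion₂.mpr ⟨c', ⟨hc', h⟩, hpc'⟩) h2
      have hc : ∀ᶠ v in 𝓝[≠] c.2, ((c.1, v) : Plane) ∉ (Φ.ngModel r).carrier := by
        -- `2 * c₀.2 - c.2` is the height of the mirror image of `c` on the circle, the only other
        -- point of the loop on this vertical line.
        have hrefl : ∀ᶠ v in 𝓝[≠] c.2, v ≠ 2 * c₀.2 - c.2 := by
          by_cases h : c.2 = 2 * c₀.2 - c.2
          · rw [← h]
            exact self_mem_nhdsWithin
          · exact eventually_nhdsWithin_of_eventually_nhds (isOpen_ne.mem_nhds h)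
        filter_upwards [hvert hU, self_mem_nhdsWithin, hrefl] with v hv hne hne' hmem
        have h1 : _ = _ := hv hmem
        have h2 : _ = _ := hcl
        have h3 : (v - c.2) * (v - (2 * c₀.2 - c.2)) = 0 := by
          simp only at h1
          linarith
        rcases mul_eq_zero.mp h3 with h | h
        · exact hne (sub_eq_zero.mp h)
        · exact hne' (sub_eq_zero.mp h)
      obtain ⟨p, hpP, hp⟩ :=
        (hfreq.and_eventually (eventually_between_of_rightmost hK hmax hc hU)).exists
      obtain ⟨u, w, hup, hpw, ⟨huK, huU⟩, hwK, hwU⟩ := hp hpP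
      exact Set.disjoint_left.mp (hloop c₀ hc₀) hpP
        (mem_loopInterior_of_between (huU huK) (hwU hwK) hup hpw)
    -- Off the diagram, the enclosing points of the diagram would lie in a neighbourhood that misses
    -- it.
    · have hU := hK.isOpen_compl.mem_nhds hcK
      obtain ⟨p, hpP, hp⟩ := (hfreq.and_eventually
        (eventually_between_of_rightmost hK hmax (hvert hU) hU)).exists
      obtain ⟨u, w, -, -, ⟨huK, huU⟩, -⟩ := hp hpP
      exact huU huK

/-! ### Area inequalities of the resolved front -/

-- The overstrand consists of half-strands `0` and `2`, so the even quadrants are positive and the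
-- odd ones negative.
open Classical in
theorem areaCoeff_ngModel (r : Plane → ℝ) (P : Set Plane) (q : Φ.Generator) :
    (Φ.ngModel r).areaCoeff P q =
      (if P ∈ (Φ.ngModel r).quadrant q 0 then 1 else 0) -
      (if P ∈ (Φ.ngModel r).quadrant q 1 then 1 else 0) +
      (if P ∈ (Φ.ngModel r).quadrant q 2 then 1 else 0) -
      (if P ∈ (Φ.ngModel r).quadrant q 3 then 1 else 0) := by
  have h0 : (Φ.ngModel r).reebSign q 0 = 1 := by simp [CrossingDiagram.reebSign, ngModel]
  have h1 : (Φ.ngModel r).reebSign q 1 = -1 := by simp [CrossingDiagram.reebSign, ngModel]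
  have h2 : (Φ.ngModel r).reebSign q 2 = 1 := by simp [CrossingDiagram.reebSign, ngModel]
  have h3 : (Φ.ngModel r).reebSign q 3 = -1 := by simp [CrossingDiagram.reebSign, ngModel]
  rw [CrossingDiagram.areaCoeff, Fin.sum_univ_four, h0, h1, h2, h3]
  split_ifs <;> rfl

theorem areaCoeff_ngModel_nonneg {r : Plane → ℝ} {P : Set Plane} {q : Φ.Generator}
    (h1 : P ∉ (Φ.ngModel r).quadrant q 1) (h3 : P ∉ (Φ.ngModel r).quadrant q 3) :
    0 ≤ (Φ.ngModel r).areaCoeff P q := by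
  rw [areaCoeff_ngModel, if_neg h1, if_neg h3]
  split_ifs <;> norm_num

theorem areaCoeff_ngModel_pos {r : Plane → ℝ} {P : Set Plane} {q : Φ.Generator}
    (h1 : P ∉ (Φ.ngModel r).quadrant q 1) (h3 : P ∉ (Φ.ngModel r).quadrant q 3)
    (h : P ∈ (Φ.ngModel r).quadrant q 0 ∨ P ∈ (Φ.ngModel r).quadrant q 2) :
    0 < (Φ.ngModel r).areaCoeff P q := by
  rw [areaCoeff_ngModel, if_neg h1, if_neg h3]
  split_ifs <;> simp_all

/-- A set in the north or south quadrant of `q` has points arbitrarily close to `q` on the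
vertical line through `q`. -/
theorem frequently_of_mem_quadrant {r : Plane → ℝ} {P : Set Plane} {q : Φ.Generator}
    (h : P ∈ (Φ.ngModel r).quadrant q 1 ∨ P ∈ (Φ.ngModel r).quadrant q 3) :
    ∃ᶠ p in 𝓝 q.1, p ∈ P ∧ p.1 = q.1.1 := by
  have hline : Tendsto (fun v : ℝ => ((q.1.1, v) : Plane)) (𝓝 q.1.2) (𝓝 q.1) :=
    (by fun_prop : Continuous (fun v : ℝ => ((q.1.1, v) : Plane))).tendsto q.1.2
  rcases h with h | h
  · have hev : ∀ᶠ v in 𝓝[>] q.1.2, ((q.1.1, v) : Plane) ∈ P := by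
      refine (tendsto_nhdsWithin_iff.mpr ⟨hline.mono_left nhdsWithin_le_nhds, ?_⟩) h
      filter_upwards [self_mem_nhdsWithin] with v hv
      exact ⟨rfl, hv⟩
    exact (hline.mono_left nhdsWithin_le_nhds).frequently
      (hev.mono fun v hv => ⟨hv, rfl⟩).frequently
  · have hev : ∀ᶠ v in 𝓝[<] q.1.2, ((q.1.1, v) : Plane) ∈ P := by
      refine (tendsto_nhdsWithin_iff.mpr ⟨hline.mono_left nhdsWithin_le_nhds, ?_⟩) h
      filter_upwards [self_mem_nhdsWithin] with v hv
      exact ⟨rfl, hv⟩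
    exact (hline.mono_left nhdsWithin_le_nhds).frequently
      (hev.mono fun v hv => ⟨hv, rfl⟩).frequently

/-- An open set containing a point on the vertical line through `q` also contains points to its
right. Thus no patch has a negative corner at, or to the right of, its rightmost point. -/
theorem exists_fst_lt_of_mem_quadrant {r : Plane → ℝ} {P : Set Plane} (hP : IsOpen P)
    {q : Φ.Generator} (h : P ∈ (Φ.ngModel r).quadrant q 1 ∨ P ∈ (Φ.ngModel r).quadrant q 3) :
    ∃ p ∈ P, q.1.1 < p.1 := by
  obtain ⟨p, hpP, hpq⟩ := (frequently_of_mem_quadrant h).exists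
  obtain ⟨ε, hε, hball⟩ := Metric.isOpen_iff.mp hP p hpP
  refine ⟨(p.1 + ε / 2, p.2), hball ?_, by simp only; linarith⟩
  rw [Metric.mem_ball, Prod.dist_eq, max_lt_iff, Real.dist_eq, Real.dist_eq]
  simp [abs_of_pos (half_pos hε), hε]

/-- The closed disc meets the front only in `c`, so `q` would be `c`; but the open disc lies
strictly to the right of the vertical line through `c`. -/
theorem loopInterior_notMem_quadrant {r : Plane → ℝ} (hr : Φ.AdmissibleRadii r) {c : Plane}
    (hc : c ∈ Φ.rightCusps) (q : Φ.Generator) :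
    ¬ (loopInterior c (r c) ∈ (Φ.ngModel r).quadrant q 1 ∨
      loopInterior c (r c) ∈ (Φ.ngModel r).quadrant q 3) := by
  intro h
  have hfreq := frequently_of_mem_quadrant h
  have hclosed : IsClosed (loop c (r c) ∪ loopInterior c (r c)) := by
    have : loop c (r c) ∪ loopInterior c (r c) =
        {p | (p.1 - (c.1 + r c)) ^ 2 + (p.2 - c.2) ^ 2 ≤ r c ^ 2} := by
      ext p
      simp [loop, loopInterior, le_iff_eq_or_lt]
    rw [this]
    exact isClosed_le (by fun_prop) (by fun_prop)
  have hq : q.1 ∈ loop c (r c) ∪ loopInterior c (r c) :=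
    hclosed.mem_of_frequently_of_tendsto (hfreq.mono fun p hp => Or.inr hp.1) tendsto_id
  have hqΦ : q.1 ∈ Φ.carrier := by
    rcases q.2 with ⟨s, -, -, hs, -, hqs, -⟩ | hq'
    · exact ⟨s, Ioo_subset_Icc_self hs, hqs⟩
    · exact rightCusps_subset_carrier hq'
  have hqc : q.1 ∈ ({c} : Set Plane) := (hr.1 c hc).2 ▸ ⟨hq, hqΦ⟩
  obtain ⟨p, hp, hpq⟩ := hfreq.exists
  rw [mem_singleton_iff.mp hqc] at hpq
  rw [loopInterior, mem_ofPred_eq, hpq] at hp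
  nlinarith [sq_nonneg (p.2 - c.2)]

theorem loopInterior_mem_quadrant {r : Plane → ℝ} {q : Φ.Generator} (hq : q.1 ∈ Φ.rightCusps) :
    loopInterior q.1 (r q.1) ∈ (Φ.ngModel r).quadrant q 0 := by
  refine mem_of_superset self_mem_nhdsWithin ?_
  rintro p (⟨h, -⟩ | ⟨-, h⟩)
  · exact absurd hq (Set.disjoint_left.mp disjoint_crossings_rightCusps h)
  · exact h

/-- In every nonempty set of area inequalities of the resolved front, some height has only
non-negative coefficients, not all zero. -/
theorem exists_generator_of_subset_areaInequalities {r : Plane → ℝ} (hr : Φ.AdmissibleRadii r)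
    {S : Set (Φ.Generator → ℤ)} (hS : S ⊆ (Φ.ngModel r).areaInequalities) (hne : S.Nonempty) :
    ∃ q, (∀ f ∈ S, 0 ≤ f q) ∧ ∃ f ∈ S, 0 < f q := by
  set D := Φ.ngModel r
  -- The crossings that are rightmost points of patches with inequality in `S`.
  set W : Set Φ.Generator := {q | ∃ P, D.IsAreaPatch P ∧ D.areaCoeff P ∈ S ∧
    P ∈ D.quadrant q 2 ∧ ∀ p ∈ P, p.1 ≤ q.1.1}
  have hloopOr : ∀ P, D.IsAreaPatch P → D.areaCoeff P ∈ S →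
      (∃ c ∈ Φ.rightCusps, P = loopInterior c (r c)) ∨
      ∃ q ∈ W, P ∈ D.quadrant q 2 ∧ ∀ p ∈ P, p.1 ≤ q.1.1 := by
    intro P hP hPS
    by_cases h : ∀ c ∈ Φ.rightCusps, Disjoint P (loopInterior c (r c))
    · obtain ⟨q, hq⟩ := exists_west_of_isAreaPatch hr hP h
      exact Or.inr ⟨q, ⟨P, hP, hPS, hq⟩, hq⟩
    · push Not at h
      obtain ⟨c, hc, hmeet⟩ := h
      obtain ⟨⟨x, -, rfl⟩, -⟩ := hP
      exact Or.inl ⟨c, hc, connectedComponentIn_eq_loopInterior hr hc hmeet⟩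
  rcases W.eq_empty_or_nonempty with hempty | hWne
  · have hloop : ∀ P, D.IsAreaPatch P → D.areaCoeff P ∈ S →
        ∃ c ∈ Φ.rightCusps, P = loopInterior c (r c) := fun P hP hPS =>
      (hloopOr P hP hPS).resolve_right fun ⟨q, hq, _⟩ => by simp [hempty] at hq
    obtain ⟨f, hf⟩ := hne
    obtain ⟨P, hP, rfl⟩ := hS hf
    obtain ⟨c, hc, rfl⟩ := hloop P hP hf
    refine ⟨⟨c, Or.inr hc⟩, fun g hg => ?_, _, hf, ?_⟩
    · obtain ⟨P', hP', rfl⟩ := hS hg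
      obtain ⟨c', hc', rfl⟩ := hloop P' hP' hg
      have := not_or.mp (loopInterior_notMem_quadrant hr hc' ⟨c, Or.inr hc⟩)
      exact areaCoeff_ngModel_nonneg this.1 this.2
    · have := not_or.mp (loopInterior_notMem_quadrant hr hc ⟨c, Or.inr hc⟩)
      exact areaCoeff_ngModel_pos this.1 this.2
        (Or.inl (loopInterior_mem_quadrant (q := ⟨c, Or.inr hc⟩) hc))
  · obtain ⟨q, ⟨P, hP, hPS, hPq, -⟩, hqmax⟩ :=
      W.toFinite.exists_maximalFor (fun q => q.1.1) W hWne
    have hnot : ∀ P', D.IsAreaPatch P' → D.areaCoeff P' ∈ S →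
        ¬ (P' ∈ D.quadrant q 1 ∨ P' ∈ D.quadrant q 3) := by
      intro P' hP' hPS' h
      rcases hloopOr P' hP' hPS' with ⟨c, hc, rfl⟩ | ⟨q', hq', -, hle⟩
      · exact loopInterior_notMem_quadrant hr hc q h
      · obtain ⟨p, hpP', hp⟩ :=
          exists_fst_lt_of_mem_quadrant (hP'.isOpen (isClosed_ngModel_carrier r)) h
        -- A negative corner at `q` would put the rightmost point `q'` of `P'` further right than
        -- the extremal `q`.
        have hlt : q.1.1 < q'.1.1 := hp.trans_le (hle p hpP')
        exact hlt.not_ge (hqmax hq' hlt.le)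
    refine ⟨q, fun f hf => ?_, _, hPS, ?_⟩
    · obtain ⟨P', hP', rfl⟩ := hS hf
      have := not_or.mp (hnot P' hP' hf)
      exact areaCoeff_ngModel_nonneg this.1 this.2
    · have := not_or.mp (hnot P hP hPS)
      exact areaCoeff_ngModel_pos this.1 this.2 (Or.inr hPq)

/-- The front has a strand, hence a right cusp, and the inside of its loop is a patch. -/
theorem areaInequalities_ngModel_nonempty {r : Plane → ℝ} (hr : Φ.AdmissibleRadii r) :
    (Φ.ngModel r).areaInequalities.Nonempty := by
  set s : Fin Φ.n := ⟨0, Φ.n_pos⟩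
  set c : Plane := (Φ.right s, Φ.height s (Φ.right s))
  have hc : c ∈ Φ.rightCusps := ⟨s, rfl⟩
  have hρ := (hr.1 c hc).1
  have hcenter : ((c.1 + r c, c.2) : Plane) ∈ loopInterior c (r c) := by
    simp [loopInterior, hρ]
  have hK := loopInterior_subset_compl hr hc hcenter
  refine ⟨_, _, ⟨⟨_, hK, rfl⟩, ?_⟩, rfl⟩
  rw [connectedComponentIn_eq_loopInterior hr hc
    (Set.not_disjoint_iff.mpr ⟨_, mem_connectedComponentIn hK, hcenter⟩)]
  refine (Metric.isBounded_closedBall (x := ((c.1 + r c, c.2) : Plane)) (r := r c)).subset ?_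
  intro p hp
  rw [loopInterior, mem_ofPred_eq] at hp
  rw [Metric.mem_closedBall, Prod.dist_eq, max_le_iff, Real.dist_eq, Real.dist_eq]
  exact ⟨abs_le_of_sq_le_sq (by nlinarith [sq_nonneg (p.2 - c.2)]) hρ.le,
    abs_le_of_sq_le_sq (by nlinarith [sq_nonneg (p.1 - (c.1 + r c))]) hρ.le⟩

end FrontDiagram

theorem mainTheorem6 (Φ : FrontDiagram) (D : CrossingDiagram Φ.Generator)
    (hD : Φ.IsNgResolution D) :
    ∃ tiers : List (Finset Φ.Generator), D.flood = some tiers ∧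
      ∀ q : Φ.Generator, ∃! k : Fin tiers.length, q ∈ tiers.get k := by
  obtain ⟨r, hr, H, -, -, rfl⟩ := hD
  have hsub := (Φ.ngModel r).areaInequalities_map_subset (H 1)
  obtain ⟨L, hL, hout, -⟩ := exists_floodFrom_eq_some
    ((Φ.ngModel r).map (H 1)).areaInequalities ∅
    ((FrontDiagram.areaInequalities_ngModel_nonempty hr).mono
      ((Φ.ngModel r).map_areaInequalities (H 1)))
    (fun S hS hne =>
      FrontDiagram.exists_generator_of_subset_areaInequalities hr (hS.trans hsub) hne)
    (fun _ _ q hq => absurd hq (Finset.notMem_empty q))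
  exact ⟨L, hL, fun q => hout q (Finset.notMem_empty q)⟩
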